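/- Let $F$ be a finite field with $q$ elements and let $\lambda\in F^\times$. For an integer $n>0$ identify a word $(c'_0,\dots,c'_{n-1},c_0,\dots,c_{n-1})\in F^{n}\times F^{n}=F^{2n}$ with the pair of residue classes of $\sum_j c'_jX^j$ and $\sum_j c_jX^j$ in $\big(F[X]/\langle X^{n}-\lambda\rangle\big)\times\big(F[X]/\langle X^{n}-\lambda\rangle\big)$. A $\lambda$-quasi-constacyclic code of index $2$ over $F$ is an $F[X]$-submodule $C$ of this product, regarded as a code in $F^{2n}$. Its code length is $2n$, its rate is $\mathrm R(C)=\frac{\log_q|C|}{2n}$, and its relative minimum distance is $\Delta(C)=\frac{\mathrm d(C)}{2n}$, where $\mathrm d(C)$ is the minimum Hamming distance between distinct codewords of $C$ (set to be $0$ if $C=0$). Then, for every finite field $F$ and every $\lambda\in F^\times$, the $\lambda$-quasi-constacyclic codes of index $2$ over $F$ are asymptotically good: there are positive integers $n_1,n_2,\dots$ with $n_i\to\infty$, $\lambda$-quasi-constacyclic codes $C_i\subseteq F^{2n_i}$ of index $2$ $(i=1,2,\dots)$, and a real number $\delta>0$ such that $\mathrm R(C_i)\ge\delta$ and $\Delta(C_i)\ge\delta$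 for all $i$. -/

import Mathlib

open Polynomial Filter

noncomputable section

namespace CodingTheory

/-- The minimum (Hamming) distance of a code `C` in `F ^ ι`: the least distance between two
distinct codewords. (It is `0` for a code with at most one codeword.) -/
def minDist {F ι : Type*} [DecidableEq F] [Fintype ι] (C : Set (ι → F)) : ℕ :=
  sInf {d | ∃ a ∈ C, ∃ b ∈ C, a ≠ b ∧ hammingDist a b = d}

/-- The relative minimum distance: minimum distance divided by code length. -/
def relMinDist {F ι : Type*} [DecidableEq F] [Fintype ι] (C : Set (ι → F)) : ℝ :=
  (minDist C : ℝ) / (Fintype.card ι : ℝ)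

/-- The rate: information length `log_q |C|` (with `q = |F|`) divided by code length. -/
def rate {F ι : Type*} [Fintype F] [Fintype ι] (C : Set (ι → F)) : ℝ :=
  Real.logb (Fintype.card F : ℝ) (C.ncard : ℝ) / (Fintype.card ι : ℝ)

/-- A sequence of codes over `F` is asymptotically good if the code lengths tend to infinity, and
both the rates and the relative minimum distances are bounded below by a positive constant. -/
def AsymptoticallyGood {F : Type*} [Fintype F] [DecidableEq F] {ι : ℕ → Type*}
    [∀ i, Fintype (ι i)] (C : ∀ i, Set (ι i → F)) : Prop :=
  Tendsto (fun i => Fintype.card (ι i)) atTop atTop ∧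
    ∃ δ : ℝ, 0 < δ ∧ ∀ i, δ ≤ rate (C i) ∧ δ ≤ relMinDist (C i)

/-- `F[X] / ⟨X ^ n - a⟩`, regarded as an `F[X]`-module. -/
abbrev ConstaRing {F : Type*} [Field F] (a : Fˣ) (n : ℕ) : Type _ :=
  F[X] ⧸ Ideal.span {(X ^ n - C (a : F) : F[X])}

/-- The class of `c₀ + c₁ X + ⋯ + cₙ₋₁ X ^ (n - 1)` in `F[X] / ⟨X ^ n - a⟩`; for `0 < n` this is
the usual identification of `F ^ n` with `F[X] / ⟨X ^ n - a⟩`. -/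
def toConstaRing {F : Type*} [Field F] (a : Fˣ) (n : ℕ) (c : Fin n → F) : ConstaRing a n :=
  Ideal.Quotient.mk _ (∑ j : Fin n, C (c j) * X ^ (j : ℕ))

/-- A code of length `2n` (two blocks of `n` coordinates each) is `a`-quasi-constacyclic of
index `2` if, under the identification of words with pairs of residue classes of polynomials, it is
an `F[X]`-submodule of `(F[X] / ⟨X ^ n - a⟩) × (F[X] / ⟨X ^ n - a⟩)`. -/
def IsQuasiConstacyclic {F : Type*} [Field F] (a : Fˣ) {n : ℕ}
    (K : Set (Fin n ⊕ Fin n → F)) : Prop :=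
  ∃ M : Submodule F[X] (ConstaRing a n × ConstaRing a n),
    K = {w | (toConstaRing a n (fun j => w (Sum.inl j)),
              toConstaRing a n (fun j => w (Sum.inr j))) ∈ M}

end CodingTheory

end

/-! Suppose `X ^ n - a = g * p` with `p` irreducible of degree at least `c * n`. The multiples of
`g` form a copy of the field `F[X] / (p)`, so for each residue `f` mod `p` the words `(g * u, g * u
* f)` form a code of size at least `q ^ deg p`. A nonzero word determines its `f` mod `p`. If fewer
than `q ^ deg p` words are light, some `f` avoids them all; a Chernoff bound ensures this for small
relative weight. Such `p` exist for `n = r ^ (k + s)`, with `r > q` prime. In `E = F(ζ_r)` write `a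
= b ^ r ^ s` with `b` not an `r`-th power. Then `X ^ r ^ k - b` is irreducible over `E`, and its
roots are roots of `X ^ n - a` of degree at least `r ^ k` over `F`. Since `s` does not depend on
`k`, `c = r ^ (-s)` works. -/

noncomputable section

namespace CodingTheory

/-! ### Irreducible factors of large degree -/

section Factor

variable {F : Type*} [Field F] [Fintype F]

/-- In a finite field whose unit group has order divisible by the prime `r`, every nonzero element
is an iterated `r`-th power of an element that is not itself an `r`-th power. -/
theorem exists_pow_prime_pow_eq_of_dvd_card_units {E : Type*} [Field E] [Finite E] {r : ℕ}
    (hr : r.Prime) (hdvd : r ∣ Nat.card Eˣ) (a : Eˣ) :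
    ∃ (s : ℕ) (b : Eˣ), b ^ r ^ s = a ∧ ∀ c : E, c ^ r ≠ b := by
  obtain ⟨g, hg⟩ := IsCyclic.exists_generator (α := Eˣ)
  have hord : orderOf g = Nat.card Eˣ := orderOf_eq_card_of_forall_mem_zpowers hg
  have hpos : 0 < Nat.card Eˣ := Nat.card_pos
  obtain ⟨j, hj0, hj⟩ : ∃ j : ℕ, j ≠ 0 ∧ g ^ j = a := by
    obtain ⟨i, hi⟩ := (mem_powers_iff_mem_zpowers.2 (hg a))
    -- Adding the group order makes the exponent nonzero (for `a = 1` it may vanish), so its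
    -- `r`-part is finite.
    refine ⟨i + Nat.card Eˣ, by omega, ?_⟩
    rw [pow_add, ← hord, pow_orderOf_eq_one, mul_one]
    exact hi
  obtain ⟨s, m, hm, rfl⟩ := Nat.exists_eq_pow_mul_and_not_dvd hj0 r hr.ne_one
  refine ⟨s, g ^ m, by rw [← pow_mul, mul_comm, hj], fun c hc => hm ?_⟩
  have hc0 : c ≠ 0 := by
    rintro rfl
    rw [zero_pow hr.ne_zero] at hc
    exact (g ^ m).ne_zero hc.symm
  obtain ⟨i, hi⟩ := (mem_powers_iff_mem_zpowers.2 (hg (Units.mk0 c hc0)))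
  have h : g ^ (i * r) = g ^ m := by
    ext
    rw [← hc, pow_mul, show g ^ i = Units.mk0 c hc0 from hi]
    simp
  rw [pow_eq_pow_iff_modEq, hord] at h
  exact (h.of_dvd hdvd).symm.dvd_iff (dvd_refl r) |>.2 (dvd_mul_left r i)

/-- Along a suitable sequence of exponents, `X ^ n - a` has an irreducible factor whose degree is
at least a fixed positive proportion of `n`. -/
theorem exists_irreducible_dvd_X_pow_sub_C (a : Fˣ) :
    ∃ r s : ℕ, 1 < r ∧ ∀ k : ℕ, ∃ p : F[X], Irreducible p ∧
      p ∣ X ^ r ^ (k + s) - C (a : F) ∧ r ^ k ≤ p.natDegree := by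
  -- `r > q` makes `r` different from the characteristic, so primitive `r`-th roots of unity exist,
  -- and odd, as the irreducibility criterion requires.
  obtain ⟨r, hle, hr⟩ := Nat.exists_infinite_primes (Fintype.card F + 1)
  have hq : 2 ≤ Fintype.card F := Fintype.one_lt_card
  have hrF : (r : F) ≠ 0 := by
    intro h
    have hc := (CharP.cast_eq_zero_iff F (ringChar F) r).1 h
    have hle' : ringChar F ≤ Fintype.card F :=
      Nat.le_of_dvd (by omega) ((CharP.cast_eq_zero_iff F (ringChar F) _).1 (by simp))
    rcases (Nat.dvd_prime hr).1 hc with h1 | h1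
    · exact CharP.ringChar_ne_one h1
    · omega
  have : NeZero (r : F) := ⟨hrF⟩
  have : NeZero r := ⟨hr.ne_zero⟩
  let E := CyclotomicField r F
  have : Module.Finite F E := IsCyclotomicExtension.finite {r} F E
  have : Finite E := Module.finite_of_finite F
  have hζ := IsCyclotomicExtension.zeta_spec r F E
  have hdvd : r ∣ Nat.card Eˣ := by
    have h := hζ.isUnit_unit (NeZero.ne r)
    exact h.eq_orderOf.dvd.trans (orderOf_dvd_natCard _)
  obtain ⟨s, b, hb, hbr⟩ := exists_pow_prime_pow_eq_of_dvd_card_units hr hdvd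
    (Units.map (algebraMap F E : F →* E) a)
  refine ⟨r, s, hr.one_lt, fun k => ?_⟩
  have hirr : Irreducible (X ^ r ^ k - C (b : E)) :=
    X_pow_sub_C_irreducible_of_prime_pow hr (by omega) k hbr
  have : Fact (Irreducible (X ^ r ^ k - C (b : E))) := ⟨hirr⟩
  let L := AdjoinRoot (X ^ r ^ k - C (b : E))
  let θ : L := AdjoinRoot.root _
  have hθ : θ ^ r ^ k = algebraMap E L b := root_X_pow_sub_C_pow _ _
  have hroot : aeval θ (X ^ r ^ (k + s) - C (a : F)) = 0 := by
    have hb' : (b : E) ^ r ^ s = algebraMap F E a := congrArg Units.val hb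
    rw [map_sub, map_pow, aeval_X, aeval_C, pow_add, pow_mul, hθ, ← map_pow, hb',
      ← IsScalarTower.algebraMap_apply, sub_self]
  have hn : r ^ (k + s) ≠ 0 := pow_ne_zero _ hr.ne_zero
  have hint : IsIntegral F θ := ⟨_, monic_X_pow_sub_C (a : F) hn, hroot⟩
  refine ⟨minpoly F θ, minpoly.irreducible hint, minpoly.dvd F θ hroot, ?_⟩
  have hE : minpoly E θ = X ^ r ^ k - C (b : E) := by
    symm
    refine minpoly.eq_of_irreducible_of_monic hirr ?_
      (monic_X_pow_sub_C _ (pow_ne_zero _ hr.ne_zero))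
    rw [map_sub, map_pow, aeval_X, aeval_C, hθ, sub_self]
  -- The degree of `θ` can only drop on passing from `F` to `E`, where it is `r ^ k`.
  have hdeg := natDegree_le_of_dvd (minpoly.dvd_map_of_isScalarTower F E θ)
    ((Polynomial.map_ne_zero_iff (algebraMap F E).injective).2 (minpoly.ne_zero hint))
  rwa [hE, natDegree_X_pow_sub_C, natDegree_map] at hdeg

end Factor

/-! ### Counting words of small weight -/

section Weight

variable {F ι : Type*} [Field F] [Fintype F] [DecidableEq F] [Fintype ι] [DecidableEq ι]

/-- The weight enumerator factors over coordinates: a zero entry contributes `1`, each of the `q -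
1` others `ε`. -/
theorem sum_pow_hammingNorm (ε : ℝ) :
    ∑ w : ι → F, ε ^ hammingNorm w = (1 + ((Fintype.card F : ℝ) - 1) * ε) ^ Fintype.card ι := by
  have h1 : ∀ w : ι → F, ε ^ hammingNorm w = ∏ i, if w i = 0 then 1 else ε := fun w => by
    rw [Finset.prod_ite, Finset.prod_const_one, one_mul, Finset.prod_const, hammingNorm]
  have h2 : ∑ x : F, (if x = 0 then 1 else ε) = 1 + ((Fintype.card F : ℝ) - 1) * ε := by
    rw [← Finset.add_sum_erase _ _ (Finset.mem_univ (0 : F)), if_pos rfl,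
      Finset.sum_congr rfl fun x hx => if_neg (Finset.ne_of_mem_erase hx), Finset.sum_const,
      Finset.card_erase_of_mem (Finset.mem_univ _), nsmul_eq_mul, Finset.card_univ,
      Nat.cast_pred Fintype.card_pos]
  simp_rw [h1]
  rw [← Fintype.prod_sum (fun (_ : ι) (x : F) => if x = 0 then (1 : ℝ) else ε), Finset.prod_const,
    h2, Finset.card_univ]

/-- A Chernoff-type bound for the number of words of small Hamming weight. -/
theorem ncard_hammingNorm_lt_mul_rpow_le {ε : ℝ} (hε : 0 < ε) (hε1 : ε ≤ 1) (t : ℝ) :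
    ({w : ι → F | (hammingNorm w : ℝ) < t}.ncard : ℝ) * ε ^ t ≤
      (1 + (Fintype.card F : ℝ) * ε) ^ Fintype.card ι := by
  have hq : (1 : ℝ) ≤ Fintype.card F := by exact_mod_cast Fintype.card_pos
  calc ({w : ι → F | (hammingNorm w : ℝ) < t}.ncard : ℝ) * ε ^ t
      = ∑ w : ι → F with (hammingNorm w : ℝ) < t, ε ^ t := by
        rw [Finset.sum_const, nsmul_eq_mul, ← Set.ncard_coe_finset]
        simp
    _ ≤ ∑ w : ι → F with (hammingNorm w : ℝ) < t, ε ^ hammingNorm w := by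
        refine Finset.sum_le_sum fun w hw => ?_
        rw [← Real.rpow_natCast]
        exact Real.rpow_le_rpow_of_exponent_ge hε hε1 (Finset.mem_filter.1 hw).2.le
    _ ≤ ∑ w : ι → F, ε ^ hammingNorm w :=
        Finset.sum_le_sum_of_subset_of_nonneg (Finset.subset_univ _) fun _ _ _ => by positivity
    _ ≤ _ := by
        rw [sum_pow_hammingNorm]
        have : 0 ≤ ((Fintype.card F : ℝ) - 1) * ε := mul_nonneg (by linarith) hε.le
        gcongr
        linarith

/-- First take `ε` small so that the left side is below `B`, then, with `ε` fixed, let `δ → 0`, so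
that `ε ^ δ → 1`. It is applied with `B = q ^ (c / 2)`. -/
theorem exists_one_add_mul_lt_mul_rpow (q : ℝ) {B : ℝ} (hB : 1 < B) :
    ∃ ε δ : ℝ, 0 < ε ∧ ε ≤ 1 ∧ 0 < δ ∧ 1 + q * ε < B * ε ^ δ := by
  have h1 : ∀ᶠ ε in nhdsWithin (0 : ℝ) (Set.Ioi 0), 1 + q * ε < B := by
    have hc : ContinuousAt (fun ε : ℝ => 1 + q * ε) 0 := by fun_prop
    exact (hc.eventually_lt continuousAt_const (by simpa using hB)).filter_mono
      nhdsWithin_le_nhds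
  obtain ⟨ε, ⟨hε, hε0⟩, hε1⟩ := ((h1.and self_mem_nhdsWithin).and
    (Ioc_mem_nhdsGT (zero_lt_one' ℝ))).exists
  have h2 : ∀ᶠ δ in nhdsWithin (0 : ℝ) (Set.Ioi 0), 1 + q * ε < B * ε ^ δ := by
    have hc : ContinuousAt (fun δ : ℝ => B * ε ^ δ) 0 :=
      continuousAt_const.mul (Real.continuousAt_const_rpow (ne_of_gt hε0))
    exact (continuousAt_const.eventually_lt hc (by simpa using hε)).filter_mono
      nhdsWithin_le_nhds
  obtain ⟨δ, hδ, hδ0⟩ := (h2.and self_mem_nhdsWithin).exists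
  exact ⟨ε, δ, hε0, hε1.2, hδ0, hδ⟩

end Weight

/-! ### Words as residue classes -/

section ConstaRing

variable {F : Type*} [Field F] {a : Fˣ} {n : ℕ}

theorem toConstaRing_sub (c d : Fin n → F) :
    toConstaRing a n (fun j => c j - d j) = toConstaRing a n c - toConstaRing a n d := by
  simp only [toConstaRing, C_sub, sub_mul, Finset.sum_sub_distrib, map_sub (Ideal.Quotient.mk _)]

theorem toConstaRing_surjective (hn : 0 < n) : Function.Surjective (toConstaRing a n) := by
  intro x
  obtain ⟨P, rfl⟩ := Ideal.Quotient.mk_surjective x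
  have hm : (X ^ n - C (a : F)).Monic := monic_X_pow_sub_C _ hn.ne'
  have hlt : (P %ₘ (X ^ n - C (a : F))).natDegree < n := by
    have h := natDegree_modByMonic_lt P hm (fun h => by
      have := congrArg natDegree h
      rw [natDegree_X_pow_sub_C, natDegree_one] at this
      omega)
    rwa [natDegree_X_pow_sub_C] at h
  refine ⟨fun j => (P %ₘ (X ^ n - C (a : F))).coeff j, ?_⟩
  rw [toConstaRing, Fin.sum_univ_eq_sum_range
    (fun j => C ((P %ₘ (X ^ n - C (a : F))).coeff j) * X ^ j) n,
    ← as_sum_range_C_mul_X_pow' _ hlt, Ideal.Quotient.eq, Ideal.mem_span_singleton]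
  refine ⟨-(P /ₘ (X ^ n - C (a : F))), ?_⟩
  linear_combination modByMonic_add_div P (X ^ n - C (a : F))

theorem eq_zero_of_toConstaRing_eq_zero (hn : 0 < n) {c : Fin n → F}
    (h : toConstaRing a n c = 0) : c = 0 := by
  rw [toConstaRing, Ideal.Quotient.eq_zero_iff_mem, Ideal.mem_span_singleton] at h
  have h0 : ∑ j : Fin n, C (c j) * X ^ (j : ℕ) = 0 := by
    refine eq_zero_of_dvd_of_degree_lt h ?_
    rw [degree_X_pow_sub_C hn]
    exact degree_sum_fin_lt c
  funext j
  have hj := congrArg (fun P => coeff P (j : ℕ)) h0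
  simpa [finsetSum_coeff, coeff_C_mul, coeff_X_pow, Fin.val_inj] using hj

end ConstaRing

/-! ### Codes generated by a pair and the counting argument -/

section Code

variable {F : Type*} [Field F]

/-- The words corresponding to the `F[X]`-submodule generated by the pair `(g, g f)`. -/
def pairCode (a : Fˣ) (n : ℕ) (g f : F[X]) : Set (Fin n ⊕ Fin n → F) :=
  {w | ∃ u : F[X], toConstaRing a n (fun j => w (Sum.inl j)) = Ideal.Quotient.mk _ (g * u) ∧
    toConstaRing a n (fun j => w (Sum.inr j)) = Ideal.Quotient.mk _ (g * u * f)}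

variable {a : Fˣ} {n : ℕ} {p g : F[X]}

theorem isQuasiConstacyclic_pairCode (f : F[X]) :
    IsQuasiConstacyclic a (pairCode a n g f) := by
  refine ⟨Submodule.span F[X] {(Ideal.Quotient.mk _ g, Ideal.Quotient.mk _ (g * f))}, ?_⟩
  ext w
  simp only [pairCode, Set.mem_ofPred_eq, Submodule.mem_span_singleton, Prod.smul_mk, Prod.mk.injEq]
  refine exists_congr fun u => ?_
  have h : ∀ P : F[X], u • (Ideal.Quotient.mk (Ideal.span {(X ^ n - C (a : F) : F[X])}) P) =
      Ideal.Quotient.mk _ (u * P) := fun P => rfl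
  rw [h, h, eq_comm, mul_comm g u, eq_comm (a := toConstaRing a n fun j => w (Sum.inr j)),
    mul_assoc]

/-- Cancelling `g` turns congruence mod `g * p` into congruence mod `p`. -/
theorem mk_mul_eq_mk_mul_iff (hpg : g * p = X ^ n - C (a : F)) (hg : g ≠ 0) (u v : F[X]) :
    (Ideal.Quotient.mk (Ideal.span {(X ^ n - C (a : F) : F[X])}) (g * u)) =
      Ideal.Quotient.mk _ (g * v) ↔ p ∣ u - v := by
  rw [Ideal.Quotient.eq, Ideal.mem_span_singleton, ← hpg, ← mul_sub, mul_dvd_mul_iff_left hg]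

theorem sub_mem_pairCode {f : F[X]} {v w : Fin n ⊕ Fin n → F} (hv : v ∈ pairCode a n g f)
    (hw : w ∈ pairCode a n g f) : v - w ∈ pairCode a n g f := by
  obtain ⟨u, h1, h2⟩ := hv
  obtain ⟨u', h1', h2'⟩ := hw
  refine ⟨u - u', ?_, ?_⟩
  · rw [mul_sub, map_sub, ← h1, ← h1', ← toConstaRing_sub]; rfl
  · rw [mul_sub, sub_mul, map_sub, ← h2, ← h2', ← toConstaRing_sub]; rfl

/-- The left half fixes `u` mod `p`. As the word is nonzero, `p` does not divide `u`, so `u` cancels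
mod `p` in the right half. -/
theorem dvd_sub_of_mem_pairCode (hn : 0 < n) (hpg : g * p = X ^ n - C (a : F)) (hg : g ≠ 0)
    (hp : Irreducible p) {f f' : F[X]} {w : Fin n ⊕ Fin n → F} (hw0 : w ≠ 0)
    (hw : w ∈ pairCode a n g f) (hw' : w ∈ pairCode a n g f') : p ∣ f - f' := by
  obtain ⟨u, h1, h2⟩ := hw
  obtain ⟨u', h1', h2'⟩ := hw'
  have hu : p ∣ u - u' := (mk_mul_eq_mk_mul_iff hpg hg _ _).1 (h1.symm.trans h1')
  have hf : p ∣ u * f - u' * f' := by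
    rw [← mk_mul_eq_mk_mul_iff hpg hg, ← mul_assoc, ← mul_assoc]
    exact h2.symm.trans h2'
  have hdvd : p ∣ u * (f - f') := by
    have h : u * (f - f') = u * f - u' * f' - (u - u') * f' := by ring
    rw [h]
    exact dvd_sub hf (hu.mul_right _)
  refine (hp.prime.dvd_or_dvd hdvd).resolve_left fun hpu => hw0 ?_
  have hzero : ∀ v : F[X], p ∣ v →
      (Ideal.Quotient.mk (Ideal.span {(X ^ n - C (a : F) : F[X])}) (g * v)) = 0 := fun v hv => by
    have h := (mk_mul_eq_mk_mul_iff hpg hg v 0).2 (by simpa using hv)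
    simpa using h
  have e1 := eq_zero_of_toConstaRing_eq_zero hn (h1.trans (hzero u hpu))
  have e2 := eq_zero_of_toConstaRing_eq_zero hn
    (h2.trans (by rw [mul_assoc]; exact hzero _ (hpu.mul_right f)))
  funext j
  rcases j with j | j
  · exact congrFun e1 j
  · exact congrFun e2 j

theorem eq_of_dvd_sub_of_mem_degreeLT {u v : F[X]} (hu : u ∈ degreeLT F p.natDegree)
    (hv : v ∈ degreeLT F p.natDegree) (hp : p ≠ 0) (h : p ∣ u - v) : u = v := by
  rw [← sub_eq_zero]
  refine eq_zero_of_dvd_of_degree_lt h ?_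
  rw [degree_eq_natDegree hp]
  exact mem_degreeLT.1 (Submodule.sub_mem _ hu hv)

theorem natCard_degreeLT [Fintype F] (d : ℕ) :
    Nat.card (degreeLT F d) = Fintype.card F ^ d := by
  rw [Nat.card_congr (degreeLTEquiv F d).toEquiv]
  simp

variable [Fintype F]

theorem card_pow_natDegree_le_ncard_pairCode (hn : 0 < n) (hpg : g * p = X ^ n - C (a : F))
    (hg : g ≠ 0) (hp : p ≠ 0) (f : F[X]) :
    Fintype.card F ^ p.natDegree ≤ (pairCode a n g f).ncard := by
  choose inv hinv using toConstaRing_surjective (a := a) hn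
  rw [← natCard_degreeLT, ← Nat.card_coe_set_eq]
  refine Nat.card_le_card_of_injective (fun u : degreeLT F p.natDegree =>
    (⟨Sum.elim (inv (Ideal.Quotient.mk _ (g * u))) (inv (Ideal.Quotient.mk _ (g * u * f))),
      u, hinv _, hinv _⟩ : pairCode a n g f)) fun u v huv => ?_
  have h : inv (Ideal.Quotient.mk _ (g * u)) = inv (Ideal.Quotient.mk _ (g * v)) :=
    funext fun j => congrFun (congrArg Subtype.val huv) (Sum.inl j)
  have h' := congrArg (toConstaRing a n) h
  rw [hinv, hinv, mk_mul_eq_mk_mul_iff hpg hg] at h'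
  exact Subtype.ext (eq_of_dvd_sub_of_mem_degreeLT u.2 v.2 hp h')

variable [DecidableEq F]

/-- If there are fewer words of weight below `t` than residues modulo `p`, then some pair code has
no nonzero word of weight below `t`. -/
theorem exists_pairCode_forall_le_hammingNorm (hn : 0 < n) (hpg : g * p = X ^ n - C (a : F))
    (hg : g ≠ 0) (hp : Irreducible p) {t : ℝ}
    (ht : {w : Fin n ⊕ Fin n → F | (hammingNorm w : ℝ) < t}.ncard <
      Fintype.card F ^ p.natDegree) :
    ∃ f : F[X], ∀ w ∈ pairCode a n g f, w ≠ 0 → t ≤ hammingNorm w := by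
  -- Otherwise choose a light nonzero word for each residue `f`; the choice is injective,
  -- contradicting the count.
  by_contra! hbad
  choose w hw hw0 hwt using hbad
  refine ht.not_ge ?_
  rw [← natCard_degreeLT, ← Nat.card_coe_set_eq]
  refine Nat.card_le_card_of_injective (fun f : degreeLT F p.natDegree =>
    (⟨w f, hwt f⟩ : {w : Fin n ⊕ Fin n → F | (hammingNorm w : ℝ) < t})) fun f f' hff => ?_
  have h : w f = w f' := congrArg Subtype.val hff
  exact Subtype.ext (eq_of_dvd_sub_of_mem_degreeLT f.2 f'.2 hp.ne_zero
    (dvd_sub_of_mem_pairCode hn hpg hg hp (hw0 f) (hw f) (h ▸ hw f')))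

theorem le_minDist_pairCode {f : F[X]} {t : ℝ} (hcard : 1 < (pairCode a n g f).ncard)
    (ht : ∀ w ∈ pairCode a n g f, w ≠ 0 → t ≤ hammingNorm w) :
    t ≤ minDist (pairCode a n g f) := by
  -- Two distinct codewords make the set of distances nonempty, so its infimum is attained rather
  -- than the default `0`.
  obtain ⟨v, hv, w, hw, hvw⟩ := (Set.one_lt_ncard).1 hcard
  obtain ⟨v, hv, w, hw, hvw, hd⟩ := Nat.sInf_mem
    (s := {d | ∃ v ∈ pairCode a n g f, ∃ w ∈ pairCode a n g f, v ≠ w ∧ hammingDist v w = d})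
    ⟨_, v, hv, w, hw, hvw, rfl⟩
  rw [minDist, ← hd, hammingDist_comm, hammingDist_eq_hammingNorm, neg_add_eq_sub]
  exact ht _ (sub_mem_pairCode hv hw) (sub_ne_zero.2 hvw)

/-- If `X ^ n - a` has an irreducible factor of degree at least `c n`, then there is a
quasi-constacyclic code of index `2` of rate at least `c / 2` and relative minimum distance at
least `δ`, for every `δ` satisfying the stated inequality. -/
theorem exists_isQuasiConstacyclic_of_irreducible_dvd (hn : 0 < n) (hp : Irreducible p)
    (hdvd : p ∣ X ^ n - C (a : F)) {c ε δ : ℝ} (hc : c * n ≤ p.natDegree)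
    (hε : 0 < ε) (hε1 : ε ≤ 1)
    (hδ : 1 + (Fintype.card F : ℝ) * ε < (Fintype.card F : ℝ) ^ (c / 2) * ε ^ δ) :
    ∃ K : Set (Fin n ⊕ Fin n → F), IsQuasiConstacyclic a K ∧ c / 2 ≤ rate K ∧
      δ ≤ relMinDist K := by
  obtain ⟨g, hg⟩ := hdvd
  replace hg : g * p = X ^ n - C (a : F) := by rw [hg, mul_comm]
  have hg0 : g ≠ 0 := by
    rintro rfl
    rw [zero_mul] at hg
    exact X_pow_sub_C_ne_zero hn _ hg.symm
  have hq : (1 : ℝ) < Fintype.card F := by exact_mod_cast Fintype.one_lt_card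
  have hN : Fintype.card (Fin n ⊕ Fin n) = n + n := by simp
  have hn' : (0 : ℝ) < n := by exact_mod_cast hn
  have hcount : {w : Fin n ⊕ Fin n → F | (hammingNorm w : ℝ) < δ * (n + n : ℕ)}.ncard <
      Fintype.card F ^ p.natDegree := by
    have h := ncard_hammingNorm_lt_mul_rpow_le (F := F) (ι := Fin n ⊕ Fin n) hε hε1
      (δ * (n + n : ℕ))
    rw [hN] at h
    -- Raising `hδ` to the power `2 * n` turns `q ^ (c / 2)` into `q ^ (c * n)`, which is at most `q
    -- ^ deg p`.
    have h2 : (1 + (Fintype.card F : ℝ) * ε) ^ (n + n) <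
        (Fintype.card F : ℝ) ^ p.natDegree * ε ^ (δ * (n + n : ℕ)) := by
      calc (1 + (Fintype.card F : ℝ) * ε) ^ (n + n)
          < ((Fintype.card F : ℝ) ^ (c / 2) * ε ^ δ) ^ (n + n) :=
            pow_lt_pow_left₀ hδ (by positivity) (by omega)
        _ = (Fintype.card F : ℝ) ^ (c * n) * ε ^ (δ * (n + n : ℕ)) := by
            rw [mul_pow, ← Real.rpow_natCast, ← Real.rpow_mul (by positivity),
              ← Real.rpow_natCast (ε ^ δ), ← Real.rpow_mul hε.le]
            congr 2
            push_cast
            ring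
        _ ≤ _ := by
            gcongr
            rw [← Real.rpow_natCast]
            exact Real.rpow_le_rpow_of_exponent_le hq.le hc
    have h3 := lt_of_mul_lt_mul_right (h.trans_lt h2) (by positivity)
    exact_mod_cast h3
  obtain ⟨f, hf⟩ := exists_pairCode_forall_le_hammingNorm hn hg hg0 hp hcount
  have hcard := card_pow_natDegree_le_ncard_pairCode hn hg hg0 hp.ne_zero f
  refine ⟨pairCode a n g f, isQuasiConstacyclic_pairCode f, ?_, ?_⟩
  · rw [rate, hN, le_div_iff₀ (by positivity),
      Real.le_logb_iff_rpow_le hq (by exact_mod_cast (by positivity : 0 < _).trans_le hcard)]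
    calc (Fintype.card F : ℝ) ^ (c / 2 * ((n + n : ℕ) : ℝ))
        ≤ (Fintype.card F : ℝ) ^ (p.natDegree : ℝ) := by
          refine Real.rpow_le_rpow_of_exponent_le hq.le (le_trans (le_of_eq ?_) hc)
          push_cast
          ring
      _ ≤ _ := by
          rw [Real.rpow_natCast]
          exact_mod_cast hcard
  · rw [relMinDist, hN, le_div_iff₀ (by positivity)]
    refine le_minDist_pairCode (lt_of_lt_of_le ?_ hcard) hf
    exact Nat.one_lt_pow hp.natDegree_pos.ne' Fintype.one_lt_card

end Code

end CodingTheory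

end

/-! ### Asymptotic goodness -/

theorem corollary1p3 {F : Type*} [Field F] [Fintype F] [DecidableEq F] (a : Fˣ) :
    ∃ (n : ℕ → ℕ) (K : ∀ i, Set (Fin (n i) ⊕ Fin (n i) → F)),
      (∀ i, 0 < n i ∧ CodingTheory.IsQuasiConstacyclic a (K i)) ∧
        CodingTheory.AsymptoticallyGood K := by
  obtain ⟨r, s, hr, hfac⟩ := CodingTheory.exists_irreducible_dvd_X_pow_sub_C a
  have hr0 : (0 : ℝ) < r := by exact_mod_cast (by omega : 0 < r)
  have hq : (1 : ℝ) < Fintype.card F := by exact_mod_cast Fintype.one_lt_card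
  -- The guaranteed proportion `r ^ k / r ^ (k + s)` of the degree, the same for all `k`.
  set c : ℝ := ((r : ℝ) ^ s)⁻¹ with hc
  have hc0 : 0 < c := by positivity
  obtain ⟨ε, δ, hε, hε1, hδ0, hδ⟩ := CodingTheory.exists_one_add_mul_lt_mul_rpow
    (Fintype.card F : ℝ) (Real.one_lt_rpow hq (half_pos hc0))
  have hpos : ∀ k, 0 < r ^ (k + s) := fun k => by positivity
  have key : ∀ k, ∃ K : Set (Fin (r ^ (k + s)) ⊕ Fin (r ^ (k + s)) → F),
      CodingTheory.IsQuasiConstacyclic a K ∧ c / 2 ≤ CodingTheory.rate K ∧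
        δ ≤ CodingTheory.relMinDist K := fun k => by
    obtain ⟨p, hp, hdvd, hdeg⟩ := hfac k
    refine CodingTheory.exists_isQuasiConstacyclic_of_irreducible_dvd (hpos k) hp hdvd
      ?_ hε hε1 hδ
    have h : c * ((r ^ (k + s) : ℕ) : ℝ) = ((r ^ k : ℕ) : ℝ) := by
      rw [hc]
      push_cast
      rw [pow_add]
      field_simp
    rw [h]
    exact_mod_cast hdeg
  choose K hK hrate hdist using key
  refine ⟨fun k => r ^ (k + s), K, fun k => ⟨hpos k, hK k⟩, ?_, min (c / 2) δ,
    lt_min (half_pos hc0) hδ0, fun k => ⟨(min_le_left _ _).trans (hrate k),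
      (min_le_right _ _).trans (hdist k)⟩⟩
  refine tendsto_atTop_mono (fun k => ?_) tendsto_id
  have h : k + s < r ^ (k + s) := Nat.lt_pow_self hr
  simp only [Fintype.card_sum, Fintype.card_fin, id]
  omega
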